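/- Let $d\ge 1$ be an integer. A density operator on $\mathbb{C}^d$ is a positive semidefinite matrix $\rho\in\mathbb{C}^{d\times d}$ with $\operatorname{tr}\rho=1$; it is a pure state if moreover $\operatorname{tr}\rho^2=1$. Write $\mathbf{P}(\mathbb{C}^d)$ for the set of pure states and $\|M\|_{\mathrm{tr}}:=\frac12\operatorname{tr}\sqrt{MM^\dagger}$. For $\epsilon>0$, an external $\epsilon$-covering of $\mathbf{P}(\mathbb{C}^d)$ is a finite set $S$ of (possibly mixed) density operators on $\mathbb{C}^d$ such that every $\phi\in\mathbf{P}(\mathbb{C}^d)$ satisfies $\|\phi-\rho\|_{\mathrm{tr}}<\epsilon$ for some $\rho\in S$. The external covering number $I_{ex}$ is the minimum size of an external $\epsilon$-covering. Let $\mu$ be the unitarily invariant probability measure on the Borel sets of $\mathbf{P}(\mathbb{C}^d)$, that is, the law of $|v\rangle\langle v|$ for $v$ uniformly distributed on the unit sphere of $\mathbb{C}^d$. For a density operator $\rho$, let $B_\epsilon(\rho):=\{\psi\in\mathbf{P}(\mathbb{C}^d):\|\psi-\rho\|_{\mathrm{tr}}<\epsilon\}$. Then, for every $\epsilon\in(0,\frac12]$,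 $$I_{ex}\ \ge\ \Bigl(\frac1{2\epsilon}\Bigr)^{2(d-1)}\quad\text{for } d\ge 1,\qquad\qquad I_{ex}\ \ge\ \Bigl(\frac1{\epsilon}\Bigr)^{2(d-1)}\quad\text{for } d\ge 4,$$ and, for every density operator $\rho$ on $\mathbb{C}^d$, $$\mu(B_\epsilon(\rho))\ \le\ (2\epsilon)^{2(d-1)}\quad\text{for } d\ge 1,\qquad\qquad \mu(B_\epsilon(\rho))\ \le\ \epsilon^{2(d-1)}\quad\text{for } d\ge 4.$$ -/

import Mathlib

open MeasureTheory
open scoped ComplexOrder Pointwise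

/-- Density operators on `ℂ^d`: positive semidefinite matrices of trace one. -/
def IsDensity {d : ℕ} (ρ : Matrix (Fin d) (Fin d) ℂ) : Prop :=
  ρ.PosSemidef ∧ ρ.trace = 1

/-- Pure states on `ℂ^d`: density operators `ρ` with `tr (ρ ^ 2) = 1`. -/
def IsPure {d : ℕ} (ρ : Matrix (Fin d) (Fin d) ℂ) : Prop :=
  IsDensity ρ ∧ (ρ * ρ).trace = 1

/-- The space of pure states on `ℂ^d`, with the topology inherited from the matrices. -/
abbrev PureState (d : ℕ) : Type :=
  {ρ : Matrix (Fin d) (Fin d) ℂ // IsPure ρ}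

/-- The space of pure states carries its Borel σ-algebra. -/
noncomputable instance instMeasurableSpacePureState (d : ℕ) : MeasurableSpace (PureState d) :=
  borel (PureState d)

instance instBorelSpacePureState (d : ℕ) : BorelSpace (PureState d) :=
  ⟨rfl⟩

open scoped MatrixOrder Matrix in
/-- Half of the Schatten `1`-norm, `(1 / 2) * tr √(M M†)`. -/
noncomputable def halfTraceNorm {d : ℕ} (M : Matrix (Fin d) (Fin d) ℂ) : ℝ :=
  (1 / 2) * (CFC.sqrt (M * Mᴴ)).trace.re

/-- The trace distance of two states. -/
noncomputable def traceDist {d : ℕ} (ρ σ : Matrix (Fin d) (Fin d) ℂ) : ℝ :=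
  halfTraceNorm (ρ - σ)

/-- A finite set `S` of (possibly mixed) states is an external `ε`-covering of the set of pure
states if every pure state has trace distance `< ε` to some member of `S`. -/
def IsExternalCovering (d : ℕ) (ε : ℝ) (S : Finset (Matrix (Fin d) (Fin d) ℂ)) : Prop :=
  (∀ ρ ∈ S, IsDensity ρ) ∧ ∀ φ : PureState d, ∃ ρ ∈ S, traceDist φ.1 ρ < ε

/-- The external covering number: the minimum size of an external `ε`-covering. -/
noncomputable def externalCoveringNumber (d : ℕ) (ε : ℝ) : ℕ :=
  sInf {n : ℕ | ∃ S : Finset (Matrix (Fin d) (Fin d) ℂ), IsExternalCovering d ε S ∧ S.card = n}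

/-- The open `ε`-ball of pure states around a (possibly mixed) state `ρ`. -/
def epsBall {d : ℕ} (ε : ℝ) (ρ : Matrix (Fin d) (Fin d) ℂ) : Set (PureState d) :=
  {ψ | traceDist ψ.1 ρ < ε}

/-- The pure state `|v⟩⟨v|` of a unit vector `v`. -/
def ketbra {d : ℕ} (v : Metric.sphere (0 : EuclideanSpace ℂ (Fin d)) 1) : PureState d :=
  ⟨Matrix.vecMulVec v.1.ofLp (star v.1.ofLp), by
    have h : v.1.ofLp ⬝ᵥ star v.1.ofLp = 1 := by
      have h1 : ‖v.1‖ = 1 := by simp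
      have h2 := EuclideanSpace.inner_eq_star_dotProduct v.1 v.1
      rw [← h2, inner_self_eq_norm_sq_to_K, h1]
      simp
    refine ⟨⟨Matrix.posSemidef_vecMulVec_self_star _, ?_⟩, ?_⟩
    · rw [Matrix.trace_vecMulVec, h]
    · rw [Matrix.vecMulVec_mul_vecMulVec, dotProduct_comm, h, one_smul, Matrix.trace_vecMulVec, h]⟩

theorem continuous_ketbra {d : ℕ} : Continuous (ketbra (d := d)) := by
  refine Continuous.subtype_mk ?_ _
  fun_prop

/-- The uniform (normalized surface) probability measure on the unit sphere of `ℂ^d`. -/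
noncomputable def sphereUniform (d : ℕ) :
    Measure (Metric.sphere (0 : EuclideanSpace ℂ (Fin d)) 1) :=
  ((volume : Measure (EuclideanSpace ℂ (Fin d))).toSphere Set.univ)⁻¹ •
    (volume : Measure (EuclideanSpace ℂ (Fin d))).toSphere

/-- The unitarily invariant probability measure on the Borel sets of the space of pure states:
the law of `|v⟩⟨v|` for a uniformly distributed unit vector `v`. -/
noncomputable def pureMeasure (d : ℕ) : Measure (PureState d) :=
  (sphereUniform d).map ketbra

theorem isProbabilityMeasure_pureMeasure {d : ℕ} (hd : 1 ≤ d) :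
    IsProbabilityMeasure (pureMeasure d) := by
  have : Nonempty (Fin d) := ⟨⟨0, hd⟩⟩
  have : IsProbabilityMeasure (sphereUniform d) := by
    refine ⟨?_⟩
    rw [sphereUniform, Measure.smul_apply, smul_eq_mul]
    refine ENNReal.inv_mul_cancel ?_ (measure_ne_top _ _)
    rw [Ne, Measure.measure_univ_eq_zero]
    exact Measure.toSphere_ne_zero _
  exact Measure.isProbabilityMeasure_map continuous_ketbra.measurable.aemeasurable

/-- The action `ψ ↦ U ψ U†` of a unitary on pure states. -/
def unitaryConj {d : ℕ} (U : Matrix.unitaryGroup (Fin d) ℂ) (ψ : PureState d) : PureState d :=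
  ⟨U.1 * ψ.1 * star U.1, by
    have hU : star U.1 * U.1 = 1 := Matrix.mem_unitaryGroup_iff'.1 U.2
    obtain ⟨⟨h1, h2⟩, h3⟩ := ψ.2
    refine ⟨⟨h1.mul_mul_conjTranspose_same U.1, ?_⟩, ?_⟩
    · rw [Matrix.trace_mul_comm, ← mul_assoc, hU, one_mul, h2]
    · have : U.1 * ψ.1 * star U.1 * (U.1 * ψ.1 * star U.1) = U.1 * (ψ.1 * ψ.1) * star U.1 := by
        simp only [mul_assoc]
        rw [← mul_assoc (star U.1) U.1, hU, one_mul]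
      rw [this, Matrix.trace_mul_comm, ← mul_assoc, hU, one_mul, h3]⟩

theorem map_unitaryConj_pureMeasure {d : ℕ} (U : Matrix.unitaryGroup (Fin d) ℂ) :
    (pureMeasure d).map (unitaryConj U) = pureMeasure d := by
  have hc : Continuous (unitaryConj U) := by
    refine Continuous.subtype_mk ?_ _
    fun_prop
  let u : unitary (EuclideanSpace ℂ (Fin d) →L[ℂ] EuclideanSpace ℂ (Fin d)) :=
    ⟨Matrix.toEuclideanCLM (n := Fin d) (𝕜 := ℂ) U.1, Unitary.map_mem _ U.2⟩
  let L := Unitary.linearIsometryEquiv u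
  have hLv (v : EuclideanSpace ℂ (Fin d)) : (L v).ofLp = U.1.mulVec v.ofLp := rfl
  let LR : EuclideanSpace ℂ (Fin d) ≃ₗᵢ[ℝ] EuclideanSpace ℂ (Fin d) :=
    ⟨L.toLinearEquiv.restrictScalars ℝ, L.norm_map⟩
  have hmp : MeasurePreserving LR volume volume := LR.measurePreserving
  let f : Metric.sphere (0 : EuclideanSpace ℂ (Fin d)) 1 →
      Metric.sphere (0 : EuclideanSpace ℂ (Fin d)) 1 :=
    fun v => ⟨LR v.1, by simp⟩
  have hf : Continuous f := Continuous.subtype_mk (LR.continuous.comp continuous_subtype_val) _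
  have hsph : (volume : Measure (EuclideanSpace ℂ (Fin d))).toSphere.map f =
      (volume : Measure (EuclideanSpace ℂ (Fin d))).toSphere := by
    ext s hs
    rw [Measure.map_apply hf.measurable hs, Measure.toSphere_apply' _ (hf.measurable hs),
      Measure.toSphere_apply' _ hs,
      ← hmp.measure_preimage_emb LR.toHomeomorph.measurableEmbedding
        (Set.Ioo (0 : ℝ) 1 • (Subtype.val '' s))]
    congr 2
    ext x
    simp only [Set.mem_smul, Set.mem_image, Set.mem_preimage]
    constructor
    · rintro ⟨r, hr, y, ⟨v, hv, rfl⟩, rfl⟩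
      exact ⟨r, hr, LR v.1, ⟨f v, hv, rfl⟩, (LR.map_smul r v.1).symm⟩
    · rintro ⟨r, hr, y, ⟨v, hv, rfl⟩, h⟩
      have hw : ‖LR.symm v.1‖ = 1 := by simp
      refine ⟨r, hr, LR.symm v.1, ⟨⟨LR.symm v.1, by simp⟩, ?_, rfl⟩, ?_⟩
      · have : f ⟨LR.symm v.1, by simp⟩ = v := Subtype.ext (LR.apply_symm_apply v.1)
        rw [this]
        exact hv
      · apply LR.injective
        rw [LR.map_smul, LR.apply_symm_apply, h]
  have hcomm : unitaryConj U ∘ ketbra = ketbra ∘ f := by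
    funext v
    apply Subtype.ext
    change U.1 * Matrix.vecMulVec v.1.ofLp (star v.1.ofLp) * star U.1 =
      Matrix.vecMulVec (U.1.mulVec v.1.ofLp) (star (U.1.mulVec v.1.ofLp))
    rw [Matrix.mul_vecMulVec, Matrix.vecMulVec_mul, Matrix.star_mulVec, Matrix.star_eq_conjTranspose]
  rw [pureMeasure, Measure.map_map hc.measurable continuous_ketbra.measurable, hcomm,
    ← Measure.map_map continuous_ketbra.measurable hf.measurable, sphereUniform, Measure.map_smul,
    hsph]

/-! The covering bounds follow from the ball bounds: the balls around a covering have total measure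
at least 1.

For the ball, since `ψ - ρ` has trace zero, trace distance below `ε` forces `ψ < ρ + ε` as forms. As
`ψ = |v⟩⟨v|` has rank one, this gives `⟨v|(ρ + ε)⁻¹|v⟩ < 1` (`sum_inv_mul_norm_sq_lt_one`). By
unitary invariance `ρ` may be taken diagonal with eigenvalues `p i`, and the condition reads `∑ |v
i|² / (p i + ε) < 1 = ∑ |v i|²`. It has no solution unless some eigenvalue `1 - t` exceeds `1 - ε`.
In that case it confines `v` to a quadratic cone `∑ k j |v j|² ≤ |v i₀|²` with `k j ≥ 0`.

A Gaussian integral gives the exact measure `∏ (1 + k j)⁻¹` of the cone (`sphereUniform_real_cone`),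
which equals `∏ (ε - t)(p j + ε) / (1 - t - p j)` over the remaining `d - 1` eigenvalues, whose sum
is `t`. Each factor is at most `(2ε)²`. When `d - 1 ≥ 3` their arithmetic mean is at most `ε²`, and
AM-GM gives the sharper bound. -/

/-! ### Scalar inequalities for the factors of the cone measure -/

theorem sq_sub_sq_div_le {ε t : ℝ} (hε : ε ≤ 1 / 2) (ht : 0 ≤ t) (htε : t < ε) :
    (ε ^ 2 - t ^ 2) / (1 - 2 * t) ≤ ε ^ 2 + 2 * ε ^ 2 * t := by
  rw [div_le_iff₀ (by linarith)]
  nlinarith [mul_nonneg (sq_nonneg t) (show (0 : ℝ) ≤ 1 - 4 * ε ^ 2 by nlinarith)]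

theorem capFactor_le_four_mul_sq {ε t p : ℝ} (hε : ε ≤ 1 / 2) (hp : 0 ≤ p) (hpt : p ≤ t)
    (htε : t < ε) : (ε - t) * (p + ε) / (1 - t - p) ≤ (2 * ε) ^ 2 := by
  -- The factor increases with `p`, so `p = t` is the worst case.
  calc (ε - t) * (p + ε) / (1 - t - p) ≤ (ε - t) * (t + ε) / (1 - 2 * t) := by
        apply div_le_div₀
        · nlinarith
        · nlinarith
        · linarith
        · linarith
    _ = (ε ^ 2 - t ^ 2) / (1 - 2 * t) := by ring
    _ ≤ ε ^ 2 + 2 * ε ^ 2 * t := sq_sub_sq_div_le hε (hp.trans hpt) htε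
    _ ≤ (2 * ε) ^ 2 := by nlinarith [sq_nonneg ε]

theorem capFactor_nonneg {ε t p : ℝ} (hε : ε ≤ 1 / 2) (hp : 0 ≤ p) (hpt : p ≤ t)
    (htε : t < ε) : 0 ≤ (ε - t) * (p + ε) / (1 - t - p) :=
  div_nonneg (mul_nonneg (by linarith) (by linarith)) (by linarith)

/-- The factor is convex in `p`, and the right side is its chord over `[0, t]`. An affine bound can
be summed knowing only `∑ p j = t`. -/
theorem capFactor_le_affine {ε t p : ℝ} (hε : ε ≤ 1 / 2) (hp : 0 ≤ p) (hpt : p ≤ t)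
    (htε : t < ε) : (ε - t) * (p + ε) / (1 - t - p) ≤
      (ε - t) * ε / (1 - t) + p * ((ε - t) * (1 - t + ε) / ((1 - 2 * t) * (1 - t))) := by
  have h1 : 0 < 1 - t - p := by linarith
  have h2 : 0 < 1 - t := by linarith
  have h3 : 0 < 1 - 2 * t := by linarith
  have h : (ε - t) * (p + ε) / (1 - t - p) =
      (ε - t) * ε / (1 - t) + p * ((ε - t) * (1 - t + ε) / ((1 - t - p) * (1 - t))) := by
    field_simp
    ring
  rw [h]
  have h5 : 0 ≤ (ε - t) * (1 - t + ε) := mul_nonneg (by linarith) (by linarith)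
  have h6 : 1 - 2 * t ≤ 1 - t - p := by linarith
  gcongr

/-- By convexity the worst case concentrates all the mass `t` on one index: one factor at `p = t`
and `n - 1` factors at `p = 0`. -/
theorem sum_capFactor_le {n : ℕ} (hn : 3 ≤ n) {ε t : ℝ} (hε : ε ≤ 1 / 2) (htε : t < ε)
    {p : Fin n → ℝ} (hp : ∀ j, 0 ≤ p j) (hsum : ∑ j, p j = t) :
    ∑ j, (ε - t) * (p j + ε) / (1 - t - p j) ≤ n * ε ^ 2 := by
  have ht : 0 ≤ t := hsum ▸ Finset.sum_nonneg fun j _ => hp j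
  have hpt (j : Fin n) : p j ≤ t :=
    hsum ▸ Finset.single_le_sum (fun i _ => hp i) (Finset.mem_univ j)
  have h2 : 0 < 1 - t := by linarith
  have h3 : 0 < 1 - 2 * t := by linarith
  have hn' : (3 : ℝ) ≤ n := by exact_mod_cast hn
  have h4 : (ε - t) * ε / (1 - t) ≤ ε * (ε - t * (1 - ε)) := by
    rw [div_le_iff₀ h2]
    nlinarith [mul_nonneg (mul_nonneg ht ht) (mul_nonneg (ht.trans htε.le)
      (show (0 : ℝ) ≤ 1 - ε by linarith))]
  calc ∑ j, (ε - t) * (p j + ε) / (1 - t - p j)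
      ≤ ∑ j, ((ε - t) * ε / (1 - t) +
          p j * ((ε - t) * (1 - t + ε) / ((1 - 2 * t) * (1 - t)))) :=
        Finset.sum_le_sum fun j _ => capFactor_le_affine hε (hp j) (hpt j) htε
    _ = n * ((ε - t) * ε / (1 - t)) + t * ((ε - t) * (1 - t + ε) / ((1 - 2 * t) * (1 - t))) := by
        rw [Finset.sum_add_distrib, ← Finset.sum_mul, hsum]
        simp
    _ = (n - 1) * ((ε - t) * ε / (1 - t)) + (ε ^ 2 - t ^ 2) / (1 - 2 * t) := by
        have h5 : (ε - t) * ε / (1 - t) + t * ((ε - t) * (1 - t + ε) / ((1 - 2 * t) * (1 - t))) =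
            (ε ^ 2 - t ^ 2) / (1 - 2 * t) := by
          have h6 := h2.ne'
          have h7 := h3.ne'
          rw [mul_div_assoc', div_add_div _ _ h6 (mul_ne_zero h7 h6),
            div_eq_div_iff (mul_ne_zero h6 (mul_ne_zero h7 h6)) h7]
          ring
        rw [← h5]
        ring
    _ ≤ (n - 1) * (ε * (ε - t * (1 - ε))) + (ε ^ 2 + 2 * ε ^ 2 * t) := by
        gcongr
        · linarith
        · exact sq_sub_sq_div_le hε ht htε
    _ ≤ n * ε ^ 2 := by
        -- This is where `n ≥ 3` enters: `2 (1 - ε) ≥ 2 ε` because `ε ≤ 1/2`.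
        have : 0 ≤ ε * t * ((n - 1) * (1 - ε) - 2 * ε) :=
          mul_nonneg (mul_nonneg (by linarith) ht) (by nlinarith)
        nlinarith

theorem prod_capFactor_le_two_mul {n : ℕ} {ε t : ℝ} (hε : ε ≤ 1 / 2) (htε : t < ε)
    {p : Fin n → ℝ} (hp : ∀ j, 0 ≤ p j) (hsum : ∑ j, p j = t) :
    ∏ j, (ε - t) * (p j + ε) / (1 - t - p j) ≤ (2 * ε) ^ (2 * n) := by
  have hpt (j : Fin n) : p j ≤ t :=
    hsum ▸ Finset.single_le_sum (fun i _ => hp i) (Finset.mem_univ j)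
  calc _ ≤ ∏ _j : Fin n, (2 * ε) ^ 2 := Finset.prod_le_prod
        (fun j _ => capFactor_nonneg hε (hp j) (hpt j) htε)
        fun j _ => capFactor_le_four_mul_sq hε (hp j) (hpt j) htε
    _ = _ := by simp [pow_mul]

theorem prod_capFactor_le {n : ℕ} (hn : 3 ≤ n) {ε t : ℝ} (hε : ε ≤ 1 / 2) (htε : t < ε)
    {p : Fin n → ℝ} (hp : ∀ j, 0 ≤ p j) (hsum : ∑ j, p j = t) :
    ∏ j, (ε - t) * (p j + ε) / (1 - t - p j) ≤ ε ^ (2 * n) := by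
  have hpt (j : Fin n) : p j ≤ t :=
    hsum ▸ Finset.single_le_sum (fun i _ => hp i) (Finset.mem_univ j)
  set g : Fin n → ℝ := fun j => (ε - t) * (p j + ε) / (1 - t - p j) with hg
  have hg0 (j : Fin n) : 0 ≤ g j := capFactor_nonneg hε (hp j) (hpt j) htε
  have hn0 : n ≠ 0 := by omega
  have hn' : (0 : ℝ) < n := by positivity
  have amgm := Real.geom_mean_le_arith_mean_weighted Finset.univ (fun _ => (n : ℝ)⁻¹) g
    (fun _ _ => by positivity) (by simp [hn0]) fun j _ => hg0 j
  rw [← Finset.mul_sum, Real.finsetProd_rpow _ _ fun j _ => hg0 j] at amgm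
  have h1 : (n : ℝ)⁻¹ * ∑ j, g j ≤ ε ^ 2 := by
    rw [inv_mul_le_iff₀ hn']
    exact sum_capFactor_le hn hε htε hp hsum
  have h2 := pow_le_pow_left₀ (Real.rpow_nonneg (Finset.prod_nonneg fun j _ => hg0 j) _)
    (amgm.trans h1) n
  rwa [Real.rpow_inv_natCast_pow (Finset.prod_nonneg fun j _ => hg0 j) hn0, ← pow_mul] at h2

/-! ### Gaussian integrals and the measure of a quadratic cone on the sphere -/

/-- In polar coordinates the indicator of a cone depends only on the direction and `f ‖x‖` only on
the radius, so the integral factors. -/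
theorem MeasureTheory.Measure.integral_indicator_cone {E : Type*} [NormedAddCommGroup E]
    [NormedSpace ℝ E] [FiniteDimensional ℝ E] [Nontrivial E] [MeasurableSpace E] [BorelSpace E]
    (μ : Measure E) [μ.IsAddHaarMeasure] {C : Set E} (hC : MeasurableSet C)
    (hcone : ∀ r : ℝ, 0 < r → ∀ x, r • x ∈ C ↔ x ∈ C) (f : ℝ → ℝ) :
    ∫ x, C.indicator (fun x => f ‖x‖) x ∂μ =
      μ.toSphere.real (Subtype.val ⁻¹' C) *
        ∫ r : Set.Ioi (0 : ℝ), f r ∂Measure.volumeIoiPow (Module.finrank ℝ E - 1) := by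
  have hind (x : ({0}ᶜ : Set E)) : C.indicator (fun x => f ‖x‖) x =
      (fun p : Metric.sphere (0 : E) 1 × Set.Ioi (0 : ℝ) =>
        (Subtype.val ⁻¹' C).indicator (fun _ => (1 : ℝ)) p.1 * f p.2)
        (homeomorphUnitSphereProd E x) := by
    have hx : 0 < ‖x.1‖ := norm_pos_iff.2 x.2
    have h := hcone ‖x.1‖⁻¹ (inv_pos.2 hx) x.1
    by_cases hxC : x.1 ∈ C
    · simp [Set.indicator, hxC, h]
    · simp [Set.indicator, hxC, h]
  calc ∫ x, C.indicator (fun x => f ‖x‖) x ∂μ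
      = ∫ x : ({0}ᶜ : Set E), C.indicator (fun x => f ‖x‖) x ∂μ.comap (↑) := by
        rw [integral_subtype_comap (measurableSet_singleton _).compl
          (C.indicator fun x => f ‖x‖), restrict_compl_singleton]
    _ = ∫ p, (Subtype.val ⁻¹' C).indicator (fun _ => (1 : ℝ)) p.1 * f p.2
          ∂(μ.toSphere.prod (Measure.volumeIoiPow (Module.finrank ℝ E - 1))) := by
        rw [← μ.measurePreserving_homeomorphUnitSphereProd.integral_comp
          (Homeomorph.measurableEmbedding _)]
        exact integral_congr_ae (.of_forall hind)
    _ = _ := by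
        rw [integral_prod_mul (fun v => (Subtype.val ⁻¹' C).indicator (fun _ => (1 : ℝ)) v)
          (fun r : Set.Ioi (0 : ℝ) => f r),
          integral_indicator_const _ (measurable_subtype_coe hC)]
        simp

theorem integral_mul_exp_neg_mul_sq_Ioi {b : ℝ} (hb : 0 < b) (a : ℝ) :
    ∫ r in Set.Ioi a, r * Real.exp (-b * r ^ 2) = Real.exp (-b * a ^ 2) / (2 * b) := by
  have hd (r : ℝ) : HasDerivAt (fun r : ℝ => -Real.exp (-b * r ^ 2) / (2 * b))
      (r * Real.exp (-b * r ^ 2)) r := by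
    have h := ((((hasDerivAt_pow 2 r).const_mul (-b)).exp).neg).div_const (2 * b)
    refine h.congr_deriv ?_
    field_simp
    norm_num
    ring
  have ht : Filter.Tendsto (fun r : ℝ => -Real.exp (-b * r ^ 2) / (2 * b)) Filter.atTop
      (nhds 0) := by
    have h1 : Filter.Tendsto (fun r : ℝ => -b * r ^ 2) Filter.atTop Filter.atBot :=
      (Filter.tendsto_pow_atTop two_ne_zero).const_mul_atTop_of_neg (by linarith)
    simpa using ((Real.tendsto_exp_atBot.comp h1).neg).div_const (2 * b)
  rw [integral_Ioi_of_hasDerivAt_of_tendsto' (fun r _ => hd r)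
    (integrable_mul_exp_neg_mul_sq hb).integrableOn ht]
  ring

theorem Complex.integral_indicator_exp_neg_mul_normSq {b s : ℝ} (hb : 0 < b) (hs : 0 ≤ s) :
    ∫ z : ℂ, {z : ℂ | s ≤ ‖z‖ ^ 2}.indicator (fun z => Real.exp (-b * ‖z‖ ^ 2)) z =
      Real.pi / b * Real.exp (-b * s) := by
  rw [← Complex.integral_comp_polarCoord_symm]
  have h : ∀ p ∈ polarCoord.target,
      p.1 • {z : ℂ | s ≤ ‖z‖ ^ 2}.indicator (fun z => Real.exp (-b * ‖z‖ ^ 2))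
        (Complex.polarCoord.symm p) =
      (Set.Ici (√s)).indicator (fun r => r * Real.exp (-b * r ^ 2)) p.1 * 1 := by
    intro p hp
    have hp0 : 0 < p.1 := hp.1
    have h1 : ‖Complex.polarCoord.symm p‖ = p.1 := by
      rw [Complex.norm_polarCoord_symm, abs_of_pos hp0]
    have h2 : √s ≤ p.1 ↔ s ≤ p.1 ^ 2 := Real.sqrt_le_left hp0.le
    simp only [Set.indicator, Set.mem_ofPred_eq, h1, Set.mem_Ici, h2, smul_eq_mul, mul_one]
    split_ifs <;> simp
  rw [setIntegral_congr_fun polarCoord.open_target.measurableSet h, polarCoord_target,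
    Measure.volume_eq_prod, setIntegral_prod_mul
      ((Set.Ici (√s)).indicator fun r => r * Real.exp (-b * r ^ 2)) (fun _ => (1 : ℝ)),
    setIntegral_indicator measurableSet_Ici]
  have h3 : (Set.Ioi 0 ∩ Set.Ici (√s) : Set ℝ) =ᵐ[volume] Set.Ioi (√s) := by
    have h4 : (Set.Ioi 0 ∩ Set.Ioi (√s) : Set ℝ) = Set.Ioi (√s) := by
      rw [Set.Ioi_inter_Ioi, max_eq_right (Real.sqrt_nonneg s)]
    rw [← h4]
    exact ae_eq_set_inter (ae_eq_refl _) Ioi_ae_eq_Ici.symm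
  rw [setIntegral_congr_set h3, integral_mul_exp_neg_mul_sq_Ioi hb, Real.sq_sqrt hs]
  have h5 : ∫ _ in Set.Ioo (-Real.pi) Real.pi, (1 : ℝ) = 2 * Real.pi := by
    simp [Real.pi_pos.le, two_mul]
  rw [h5]
  field_simp

theorem Complex.integral_exp_neg_mul_normSq {b : ℝ} (hb : 0 < b) :
    ∫ z : ℂ, Real.exp (-b * ‖z‖ ^ 2) = Real.pi / b := by
  have h := Complex.integral_indicator_exp_neg_mul_normSq hb le_rfl
  have hu : {z : ℂ | 0 ≤ ‖z‖ ^ 2} = Set.univ := Set.eq_univ_of_forall fun z => sq_nonneg ‖z‖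
  simpa [hu] using h

theorem Complex.integrable_exp_neg_mul_normSq {b : ℝ} (hb : 0 < b) :
    Integrable fun z : ℂ => Real.exp (-b * ‖z‖ ^ 2) := by
  -- The Bochner integral of a non-integrable function is 0 by convention.
  refine Integrable.of_integral_ne_zero ?_
  rw [Complex.integral_exp_neg_mul_normSq hb]
  positivity

theorem integrable_exp_neg_sum_normSq (n : ℕ) :
    Integrable fun x : Fin n → ℂ => Real.exp (-∑ i, ‖x i‖ ^ 2) := by
  have h := Integrable.fintype_prod (μ := fun _ : Fin n => (volume : Measure ℂ))
    (f := fun _ (z : ℂ) => Real.exp (-1 * ‖z‖ ^ 2))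
    fun _ => Complex.integrable_exp_neg_mul_normSq one_pos
  refine h.congr (.of_forall fun x => ?_)
  simp [← Real.exp_sum]

theorem integral_exp_neg_sum_mul_normSq {n : ℕ} {b : Fin n → ℝ} (hb : ∀ i, 0 < b i) :
    ∫ x : Fin n → ℂ, Real.exp (-∑ i, b i * ‖x i‖ ^ 2) = ∏ i, Real.pi / b i := by
  rw [← Finset.prod_congr rfl fun i _ => Complex.integral_exp_neg_mul_normSq (hb i),
    ← integral_fintype_prod_volume_eq_prod]
  simp [← Real.exp_sum]

/-- Integrating out coordinate `i₀` first gives `π exp (-∑ k j |y j|²)`. The constraint thus only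
raises the Gaussian rate of each other coordinate from `1` to `1 + k j`. -/
theorem integral_indicator_exp_neg_sum_normSq {n : ℕ} (i₀ : Fin (n + 1)) {k : Fin n → ℝ}
    (hk : ∀ j, 0 ≤ k j) :
    ∫ x : Fin (n + 1) → ℂ,
      {x : Fin (n + 1) → ℂ | ∑ j, k j * ‖x (i₀.succAbove j)‖ ^ 2 ≤ ‖x i₀‖ ^ 2}.indicator
        (fun x => Real.exp (-∑ i, ‖x i‖ ^ 2)) x =
      Real.pi ^ (n + 1) * ∏ j, (1 + k j)⁻¹ := by
  set F : (Fin (n + 1) → ℂ) → ℝ :=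
    {x : Fin (n + 1) → ℂ | ∑ j, k j * ‖x (i₀.succAbove j)‖ ^ 2 ≤ ‖x i₀‖ ^ 2}.indicator
        (fun x => Real.exp (-∑ i, ‖x i‖ ^ 2)) with hF
  have hmp := (volume_preserving_piFinSuccAbove (fun _ : Fin (n + 1) => ℂ) i₀).symm
  have hmeas : MeasurableSet
      {x : Fin (n + 1) → ℂ | ∑ j, k j * ‖x (i₀.succAbove j)‖ ^ 2 ≤ ‖x i₀‖ ^ 2} :=
    measurableSet_le (by fun_prop) (by fun_prop)
  have hint : Integrable F := (integrable_exp_neg_sum_normSq (n + 1)).indicator hmeas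
  have hint' : Integrable fun p : ℂ × (Fin n → ℂ) =>
      F ((MeasurableEquiv.piFinSuccAbove (fun _ : Fin (n + 1) => ℂ) i₀).symm p) :=
    hmp.integrable_comp_of_integrable hint
  rw [← hmp.integral_comp (MeasurableEquiv.measurableEmbedding _) F]
  rw [Measure.volume_eq_prod, integral_prod_symm _ hint']
  have hs (y : Fin n → ℂ) : 0 ≤ ∑ j, k j * ‖y j‖ ^ 2 :=
    Finset.sum_nonneg fun j _ => mul_nonneg (hk j) (sq_nonneg _)
  have hval (z : ℂ) (y : Fin n → ℂ) :
      F ((MeasurableEquiv.piFinSuccAbove (fun _ : Fin (n + 1) => ℂ) i₀).symm (z, y)) =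
      {z : ℂ | ∑ j, k j * ‖y j‖ ^ 2 ≤ ‖z‖ ^ 2}.indicator (fun z => Real.exp (-1 * ‖z‖ ^ 2)) z *
        Real.exp (-∑ j, ‖y j‖ ^ 2) := by
    simp only [hF, Set.indicator, Set.mem_ofPred_eq, Fin.sum_univ_succAbove _ i₀,
      MeasurableEquiv.piFinSuccAbove_symm_apply, Fin.insertNthEquiv_apply, Fin.insertNth_apply_same,
      Fin.insertNth_apply_succAbove]
    split_ifs
    · rw [← Real.exp_add]
      ring_nf
    · simp
  simp only [hval, integral_mul_const, Complex.integral_indicator_exp_neg_mul_normSq one_pos (hs _)]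
  have hexp (y : Fin n → ℂ) : Real.pi / 1 * Real.exp (-1 * ∑ j, k j * ‖y j‖ ^ 2) *
      Real.exp (-∑ j, ‖y j‖ ^ 2) = Real.pi * Real.exp (-∑ j, (1 + k j) * ‖y j‖ ^ 2) := by
    rw [div_one, mul_assoc, ← Real.exp_add]
    simp only [add_mul, one_mul, Finset.sum_add_distrib]
    ring_nf
  simp only [hexp]
  rw [integral_const_mul, integral_exp_neg_sum_mul_normSq fun j => by linarith [hk j]]
  simp only [div_eq_mul_inv, Finset.prod_mul_distrib, Finset.prod_const, Finset.card_univ,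
    Fintype.card_fin]
  ring

theorem sphereUniform_real_cone {n : ℕ} (i₀ : Fin (n + 1)) {k : Fin n → ℝ}
    (hk : ∀ j, 0 ≤ k j) :
    (sphereUniform (n + 1)).real
      {v | ∑ j, k j * ‖v.1 (i₀.succAbove j)‖ ^ 2 ≤ ‖v.1 i₀‖ ^ 2} = ∏ j, (1 + k j)⁻¹ := by
  set e : (EuclideanSpace ℂ (Fin (n + 1))) ≃L[ℝ] (Fin (n + 1) → ℂ) :=
    PiLp.continuousLinearEquiv 2 ℝ (fun _ : Fin (n + 1) => ℂ)
  set ν : Measure (Fin (n + 1) → ℂ) := (volume : Measure (EuclideanSpace ℂ (Fin (n + 1)))).map e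
  have hν : ν.IsAddHaarMeasure := e.isAddHaarMeasure_map _
  -- The value of `c` never matters: it cancels against the case `k = 0`.
  set c := ν.addHaarScalarFactor volume
  have hνc : ν = c • volume := Measure.isAddLeftInvariant_eq_smul _ _
  have hc : c ≠ 0 := (Measure.addHaarScalarFactor_pos_of_isAddHaarMeasure ν volume).ne'
  have key (k : Fin n → ℝ) (hk : ∀ j, 0 ≤ k j) :
      (volume : Measure (EuclideanSpace ℂ (Fin (n + 1)))).toSphere.real
        {v | ∑ j, k j * ‖v.1 (i₀.succAbove j)‖ ^ 2 ≤ ‖v.1 i₀‖ ^ 2} *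
          ∫ r : Set.Ioi (0 : ℝ), Real.exp (-r.1 ^ 2)
            ∂Measure.volumeIoiPow (Module.finrank ℝ (EuclideanSpace ℂ (Fin (n + 1))) - 1) =
      c * (Real.pi ^ (n + 1) * ∏ j, (1 + k j)⁻¹) := by
    set C : Set (EuclideanSpace ℂ (Fin (n + 1))) :=
      {v | ∑ j, k j * ‖v (i₀.succAbove j)‖ ^ 2 ≤ ‖v i₀‖ ^ 2}
    have hC : MeasurableSet C := by
      refine (isClosed_le ?_ ?_).measurableSet <;> fun_prop
    have h := Measure.integral_indicator_cone (volume : Measure (EuclideanSpace ℂ (Fin (n + 1))))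
      hC (fun r hr x => by
      have hr2 : 0 < r ^ 2 := by positivity
      simp only [C, Set.mem_ofPred_eq, PiLp.smul_apply, norm_smul, mul_pow, Real.norm_eq_abs,
        sq_abs, mul_left_comm _ (r ^ 2), ← Finset.mul_sum, mul_le_mul_iff_right₀ hr2])
      (fun r => Real.exp (-r ^ 2))
    refine h.symm.trans ?_
    rw [← integral_indicator_exp_neg_sum_normSq i₀ hk]
    refine Eq.trans ?_ (integral_smul_nnreal_measure _ c)
    rw [← hνc]
    refine Eq.trans ?_ (e.toHomeomorph.measurableEmbedding.integral_map _).symm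
    refine integral_congr_ae (.of_forall fun x => ?_)
    simp only [Set.indicator, C, Set.mem_ofPred_eq, EuclideanSpace.norm_sq_eq]
    rfl
  -- For `k = 0` the cone is the whole sphere; dividing by this case removes both `c` and the radial
  -- integral.
  have h0 := key 0 fun _ => le_rfl
  have h1 := key k hk
  have hu : {v : Metric.sphere (0 : (EuclideanSpace ℂ (Fin (n + 1)))) 1 |
      ∑ j, (0 : Fin n → ℝ) j * ‖v.1 (i₀.succAbove j)‖ ^ 2 ≤ ‖v.1 i₀‖ ^ 2} = Set.univ :=
    Set.eq_univ_of_forall fun v => by simp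
  rw [hu] at h0
  have hK : (∫ r : Set.Ioi (0 : ℝ), Real.exp (-r.1 ^ 2)
      ∂Measure.volumeIoiPow (Module.finrank ℝ (EuclideanSpace ℂ (Fin (n + 1))) - 1)) ≠ 0 := by
    intro hK
    rw [hK] at h0
    simp [hc, Real.pi_ne_zero] at h0
  have hS : (volume : Measure (EuclideanSpace ℂ (Fin (n + 1)))).toSphere.real Set.univ ≠ 0 := by
    intro hS
    rw [hS] at h0
    simp [hc, Real.pi_ne_zero] at h0
  rw [sphereUniform, measureReal_ennreal_smul_apply, ENNReal.toReal_inv, ← Measure.real,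
    inv_mul_eq_iff_eq_mul₀ hS]
  refine mul_right_cancel₀ hK ?_
  rw [h1, mul_right_comm, h0]
  simp
  ring

/-! ### Inequalities for quadratic forms and the trace norm -/

theorem Complex.star_mul_self_eq (z : ℂ) : star z * z = ((‖z‖ ^ 2 : ℝ) : ℂ) := by
  rw [RCLike.star_def, Complex.conj_mul', Complex.ofReal_pow]

theorem Complex.mul_star_self_eq (z : ℂ) : z * star z = ((‖z‖ ^ 2 : ℝ) : ℂ) := by
  rw [mul_comm, Complex.star_mul_self_eq]

open scoped MatrixOrder Matrix in
theorem Matrix.PosSemidef.re_dotProduct_mulVec_le_trace_mul {n : Type*} [Fintype n] [DecidableEq n]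
    {B : Matrix n n ℂ} (hB : B.PosSemidef) (w : n → ℂ) :
    (star w ⬝ᵥ B *ᵥ w).re ≤ B.trace.re * ∑ i, ‖w i‖ ^ 2 := by
  -- With `B = C† C` the claim is Cauchy-Schwarz: `‖C w‖` is at most the Frobenius norm of `C` times
  -- `‖w‖`.
  obtain ⟨C, rfl⟩ := CStarAlgebra.nonneg_iff_eq_star_mul_self.1 (Matrix.nonneg_iff_posSemidef.2 hB)
  rw [Matrix.star_eq_conjTranspose]
  have h1 : (star w ⬝ᵥ (Cᴴ * C) *ᵥ w).re = ∑ i, ‖(C *ᵥ w) i‖ ^ 2 := by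
    rw [← Matrix.mulVec_mulVec, Matrix.dotProduct_mulVec, ← Matrix.star_mulVec, dotProduct,
      Complex.re_sum]
    refine Finset.sum_congr rfl fun i _ => ?_
    rw [Pi.star_apply, Complex.star_mul_self_eq, Complex.ofReal_re]
  have h2 : (Cᴴ * C).trace.re = ∑ i, ∑ j, ‖C i j‖ ^ 2 := by
    rw [Matrix.trace, Complex.re_sum, Finset.sum_comm]
    refine Finset.sum_congr rfl fun i _ => ?_
    rw [Matrix.diag_apply, Matrix.mul_apply, Complex.re_sum]
    refine Finset.sum_congr rfl fun j _ => ?_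
    rw [Matrix.conjTranspose_apply, Complex.star_mul_self_eq, Complex.ofReal_re]
  rw [h1, h2, Finset.sum_mul]
  refine Finset.sum_le_sum fun i _ => ?_
  calc ‖(C *ᵥ w) i‖ ^ 2 ≤ (∑ j, ‖C i j‖ * ‖w j‖) ^ 2 := by
        gcongr
        exact (norm_sum_le _ _).trans_eq (by simp)
    _ ≤ _ := Finset.sum_mul_sq_le_sq_mul_sq _ _ _

open scoped MatrixOrder Matrix in
-- With `|M| = √(M M†)`, `|M| - M ≥ 0` gives `2⟨M⟩ ≤ ⟨|M| + M⟩`. The positive matrix `|M| + M` has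
-- form at most its trace times `‖w‖²`, and that trace is `tr |M|` because `tr M = 0`. The vanishing
-- trace is what saves the factor 2.
theorem re_dotProduct_mulVec_le_halfTraceNorm_mul {d : ℕ} {M : Matrix (Fin d) (Fin d) ℂ}
    (hM : M.IsHermitian) (htr : M.trace = 0) (w : Fin d → ℂ) :
    (star w ⬝ᵥ M *ᵥ w).re ≤ halfTraceNorm M * ∑ i, ‖w i‖ ^ 2 := by
  set A := CFC.sqrt (M * Mᴴ) with hA
  have hAabs : A = CFC.abs M := by
    rw [hA, CFC.abs, Matrix.star_eq_conjTranspose, hM.eq]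
  have h1 : (A - M).PosSemidef := by
    rw [hAabs, CFC.abs_sub_self M hM, ← Matrix.nonneg_iff_posSemidef]
    exact nsmul_nonneg (CFC.negPart_nonneg M) 2
  have h2 : (A + M).PosSemidef := by
    rw [hAabs, CFC.abs_add_self M hM, ← Matrix.nonneg_iff_posSemidef]
    exact nsmul_nonneg (CFC.posPart_nonneg M) 2
  have h3 : 0 ≤ (star w ⬝ᵥ (A - M) *ᵥ w).re := h1.re_dotProduct_nonneg w
  have h4 := h2.re_dotProduct_mulVec_le_trace_mul w
  rw [Matrix.sub_mulVec, dotProduct_sub, Complex.sub_re] at h3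
  rw [Matrix.add_mulVec, dotProduct_add, Complex.add_re, Matrix.trace_add, htr, add_zero] at h4
  rw [halfTraceNorm, ← hA]
  linarith

open scoped MatrixOrder Matrix in
-- A bound visibly continuous in `M`, used to produce finite coverings by compactness.
theorem halfTraceNorm_le_sqrt {d : ℕ} {M : Matrix (Fin d) (Fin d) ℂ} :
    halfTraceNorm M ≤ 1 / 2 * √(d * (M * Mᴴ).trace.re) := by
  set A := CFC.sqrt (M * Mᴴ) with hA
  have hA0 : A.PosSemidef := Matrix.nonneg_iff_posSemidef.1 (CFC.sqrt_nonneg _)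
  have hAA : A * Aᴴ = M * Mᴴ := by
    rw [hA0.1.eq]
    exact CFC.sqrt_mul_sqrt_self _
      (Matrix.nonneg_iff_posSemidef.2 (Matrix.posSemidef_self_mul_conjTranspose M))
  rw [halfTraceNorm, ← hA, ← hAA]
  gcongr
  refine Real.le_sqrt_of_sq_le ?_
  calc A.trace.re ^ 2 = (∑ i, (A i i).re) ^ 2 := by simp [Matrix.trace]
    _ ≤ d * ∑ i, (A i i).re ^ 2 := by
        simpa using sq_sum_le_card_mul_sum_sq (s := Finset.univ) (f := fun i => (A i i).re)
    _ ≤ d * ∑ i, ∑ j, ‖A i j‖ ^ 2 := by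
        gcongr with i
        refine le_trans ?_ (Finset.single_le_sum (fun j _ => sq_nonneg ‖A i j‖)
          (Finset.mem_univ i))
        rw [← sq_abs]
        gcongr
        exact Complex.abs_re_le_norm _
    _ = d * (A * Aᴴ).trace.re := by
        rw [Matrix.trace, Complex.re_sum]
        congr 1
        refine Finset.sum_congr rfl fun i _ => ?_
        rw [Matrix.diag_apply, Matrix.mul_apply, Complex.re_sum]
        refine Finset.sum_congr rfl fun j _ => ?_
        rw [Matrix.conjTranspose_apply, Complex.mul_star_self_eq, Complex.ofReal_re]

/-! ### Pure states as unit vectors, and diagonalisation -/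

theorem unitaryConj_unitaryConj_inv {d : ℕ} (U : Matrix.unitaryGroup (Fin d) ℂ) (ψ : PureState d) :
    unitaryConj U (unitaryConj U⁻¹ ψ) = ψ := by
  apply Subtype.ext
  have h : U.1 * star U.1 = 1 := Matrix.mem_unitaryGroup_iff.1 U.2
  change U.1 * (star U.1 * ψ.1 * star (star U.1)) * star U.1 = ψ.1
  rw [star_star, ← mul_assoc, ← mul_assoc, h, one_mul, mul_assoc, h, mul_one]

theorem continuous_unitaryConj {d : ℕ} (U : Matrix.unitaryGroup (Fin d) ℂ) :
    Continuous (unitaryConj U) := by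
  refine Continuous.subtype_mk ?_ _
  fun_prop

theorem ketbra_apply_self {d : ℕ} (v : Metric.sphere (0 : EuclideanSpace ℂ (Fin d)) 1)
    (i : Fin d) : (ketbra v).1 i i = (‖v.1 i‖ ^ 2 : ℝ) :=
  Complex.mul_star_self_eq (v.1 i)

theorem sum_norm_sq_sphere {d : ℕ} (v : Metric.sphere (0 : EuclideanSpace ℂ (Fin d)) 1) :
    ∑ i, ‖v.1 i‖ ^ 2 = 1 := by
  rw [← EuclideanSpace.norm_sq_eq, norm_eq_of_mem_sphere, one_pow]

theorem unitaryConj_ketbra_mem_range {d : ℕ} (U : Matrix.unitaryGroup (Fin d) ℂ)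
    (v : Metric.sphere (0 : EuclideanSpace ℂ (Fin d)) 1) :
    unitaryConj U (ketbra v) ∈ Set.range (ketbra (d := d)) := by
  set w : EuclideanSpace ℂ (Fin d) := WithLp.toLp 2 (U.1.mulVec v.1.ofLp)
  have hc : (unitaryConj U (ketbra v)).1 = Matrix.vecMulVec w.ofLp (star w.ofLp) := by
    have h : U.1 * Matrix.vecMulVec v.1.ofLp (star v.1.ofLp) * star U.1 =
        Matrix.vecMulVec (U.1.mulVec v.1.ofLp) (star (U.1.mulVec v.1.ofLp)) := by
      rw [Matrix.mul_vecMulVec, Matrix.vecMulVec_mul, Matrix.star_mulVec,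
        Matrix.star_eq_conjTranspose]
    exact h
  have h1 := (unitaryConj U (ketbra v)).2.1.2
  rw [hc, Matrix.trace_vecMulVec, dotProduct] at h1
  simp only [Pi.star_apply, Complex.mul_star_self_eq] at h1
  have h2 : ‖w‖ ^ 2 = 1 := by
    rw [EuclideanSpace.norm_sq_eq]
    exact_mod_cast h1
  have hn : ‖w‖ = 1 := by
    rwa [pow_eq_one_iff_of_nonneg (norm_nonneg w) two_ne_zero] at h2
  exact ⟨⟨w, by simpa using hn⟩, Subtype.ext hc.symm⟩

theorem Matrix.IsHermitian.star_mul_mul_eigenvectorUnitary {d : ℕ} {ρ : Matrix (Fin d) (Fin d) ℂ}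
    (hρ : ρ.IsHermitian) :
    star hρ.eigenvectorUnitary.1 * ρ * hρ.eigenvectorUnitary.1 =
      Matrix.diagonal fun i => (hρ.eigenvalues i : ℂ) := by
  have h : star hρ.eigenvectorUnitary.1 * hρ.eigenvectorUnitary.1 = 1 :=
    Matrix.mem_unitaryGroup_iff'.1 hρ.eigenvectorUnitary.2
  have hs := hρ.spectral_theorem
  rw [Unitary.conjStarAlgAut_apply] at hs
  nth_rewrite 2 [hs]
  rw [mul_assoc, mul_assoc, mul_assoc, h, mul_one, ← mul_assoc, h, one_mul]
  rfl

theorem ketbra_surjective {d : ℕ} : Function.Surjective (ketbra (d := d)) := by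
  intro ψ
  have hψ := ψ.2.1.1
  set U := hψ.1.eigenvectorUnitary
  set p := hψ.1.eigenvalues with hp
  have hdiag : (unitaryConj U⁻¹ ψ).1 = Matrix.diagonal fun i => (p i : ℂ) := by
    change star U.1 * ψ.1 * star (star U.1) = _
    rw [star_star]
    exact hψ.1.star_mul_mul_eigenvectorUnitary
  obtain ⟨⟨-, h1⟩, h2⟩ := (unitaryConj U⁻¹ ψ).2
  rw [hdiag, Matrix.trace_diagonal] at h1
  rw [hdiag, Matrix.diagonal_mul_diagonal, Matrix.trace_diagonal] at h2
  have h1' : ∑ i, p i = 1 := by exact_mod_cast h1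
  have h2' : ∑ i, p i * p i = 1 := by exact_mod_cast h2
  have hp0 (i : Fin d) : 0 ≤ p i := hψ.eigenvalues_nonneg i
  have hp1 (i : Fin d) : p i ≤ 1 :=
    h1' ▸ Finset.single_le_sum (fun i _ => hp0 i) (Finset.mem_univ i)
  -- Trace and purity both equal 1, so every eigenvalue is 0 or 1, and exactly one is 1.
  have h3 : ∑ i, p i * (1 - p i) = 0 := by
    simp only [mul_sub, mul_one, Finset.sum_sub_distrib, h1', h2', sub_self]
  rw [Finset.sum_eq_zero_iff_of_nonneg fun i _ => mul_nonneg (hp0 i) (by linarith [hp1 i])] at h3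
  obtain ⟨i₀, -, hi₀⟩ : ∃ i ∈ Finset.univ, p i ≠ 0 :=
    Finset.exists_ne_zero_of_sum_ne_zero (by rw [h1']; exact one_ne_zero)
  have hi1 : p i₀ = 1 := by
    have := (mul_eq_zero.1 (h3 i₀ (Finset.mem_univ _))).resolve_left hi₀
    linarith
  have hother (j : Fin d) (hj : j ≠ i₀) : p j = 0 := by
    rw [← Finset.add_sum_erase _ _ (Finset.mem_univ i₀), hi1, add_eq_left,
      Finset.sum_eq_zero_iff_of_nonneg fun i _ => hp0 i] at h1'
    exact h1' j (by simp [hj])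
  have he : unitaryConj U⁻¹ ψ = ketbra ⟨EuclideanSpace.single i₀ 1, by simp⟩ := by
    apply Subtype.ext
    rw [hdiag]
    ext i j
    change _ = (EuclideanSpace.single i₀ (1 : ℂ)) i * star ((EuclideanSpace.single i₀ (1 : ℂ)) j)
    by_cases hij : i = j
    · subst hij
      by_cases hi : i = i₀
      · subst hi
        simp [hi1]
      · simp [hother i hi, hi]
    · rw [Matrix.diagonal_apply_ne _ hij]
      by_cases hi : i = i₀
      · subst hi
        simp [Ne.symm hij]
      · simp [hi]
  rw [← unitaryConj_unitaryConj_inv U ψ, he]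
  exact unitaryConj_ketbra_mem_range U _

/-! ### Measure of a ball -/

open scoped Matrix in
theorem sum_inv_mul_norm_sq_lt_one {d : ℕ} {ρ : Matrix (Fin d) (Fin d) ℂ} (hρ : IsDensity ρ)
    {ε : ℝ} (hε : 0 < ε) {ψ : PureState d} (hψ : traceDist ψ.1 ρ < ε)
    {v : Metric.sphere (0 : EuclideanSpace ℂ (Fin d)) 1}
    (hv : unitaryConj (hρ.1.1.eigenvectorUnitary)⁻¹ ψ = ketbra v) :
    ∑ i, (hρ.1.1.eigenvalues i + ε)⁻¹ * ‖v.1 i‖ ^ 2 < 1 := by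
  set U := hρ.1.1.eigenvectorUnitary
  set p := hρ.1.1.eigenvalues
  have hp (i : Fin d) : 0 < p i + ε := add_pos_of_nonneg_of_pos (hρ.1.eigenvalues_nonneg i) hε
  set q := ∑ i, (p i + ε)⁻¹ * ‖v.1 i‖ ^ 2 with hq
  -- The test vector `z = (ρ + ε)⁻¹ v` in the eigenbasis gives `⟨z|ψ|z⟩ = q²` and `⟨z|ρ + ε|z⟩ = q`,
  -- so `ψ < ρ + ε` becomes `q² < q`.
  set z : Fin d → ℂ := fun i => (p i + ε)⁻¹ * v.1 i with hz
  have hzn (i : Fin d) : ‖z i‖ ^ 2 = (p i + ε)⁻¹ ^ 2 * ‖v.1 i‖ ^ 2 := by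
    have : z i = (((p i + ε)⁻¹ : ℝ) : ℂ) * v.1 i := by simp [hz]
    rw [this, norm_mul, mul_pow, Complex.norm_real, Real.norm_eq_abs, sq_abs]
  have hconj (B : Matrix (Fin d) (Fin d) ℂ) :
      star (U.1 *ᵥ z) ⬝ᵥ B *ᵥ (U.1 *ᵥ z) = star z ⬝ᵥ (star U.1 * B * U.1) *ᵥ z := by
    rw [Matrix.star_mulVec, ← Matrix.dotProduct_mulVec, Matrix.mulVec_mulVec, Matrix.mulVec_mulVec,
      Matrix.star_eq_conjTranspose, mul_assoc]
  have hM : (ψ.1 - ρ).IsHermitian := ψ.2.1.1.1.sub hρ.1.1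
  have htr : (ψ.1 - ρ).trace = 0 := by rw [Matrix.trace_sub, ψ.2.1.2, hρ.2, sub_self]
  have key := re_dotProduct_mulVec_le_halfTraceNorm_mul hM htr (U.1 *ᵥ z)
  have hU : star U.1 * U.1 = 1 := Matrix.mem_unitaryGroup_iff'.1 U.2
  have hUz : ∑ i, ‖(U.1 *ᵥ z) i‖ ^ 2 = ∑ i, ‖z i‖ ^ 2 := by
    have hd (w : Fin d → ℂ) : ((∑ i, ‖w i‖ ^ 2 : ℝ) : ℂ) = star w ⬝ᵥ w := by
      rw [dotProduct, Complex.ofReal_sum]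
      exact Finset.sum_congr rfl fun i _ => (Complex.star_mul_self_eq _).symm
    have h1 := hconj 1
    rw [Matrix.one_mulVec, mul_one, hU, Matrix.one_mulVec, ← hd, ← hd] at h1
    exact_mod_cast h1
  have hψ' : star U.1 * ψ.1 * U.1 = Matrix.vecMulVec v.1.ofLp (star v.1.ofLp) := by
    have := congrArg Subtype.val hv
    change star U.1 * ψ.1 * star (star U.1) = _ at this
    rwa [star_star] at this
  have hzv : star z ⬝ᵥ v.1.ofLp = (q : ℂ) := by
    rw [dotProduct, hq, Complex.ofReal_sum]
    refine Finset.sum_congr rfl fun i _ => ?_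
    rw [Complex.ofReal_mul, ← Complex.star_mul_self_eq, ← mul_assoc]
    simp [hz]
  have hvz : star v.1.ofLp ⬝ᵥ z = (q : ℂ) := by
    rw [Matrix.star_dotProduct, hzv, RCLike.star_def, Complex.conj_ofReal]
  have h1 : (star z ⬝ᵥ (star U.1 * ψ.1 * U.1) *ᵥ z) = ((q ^ 2 : ℝ) : ℂ) := by
    rw [hψ', Matrix.vecMulVec_mulVec, hvz]
    simp [hzv, sq]
  have h2 : (star z ⬝ᵥ (star U.1 * ρ * U.1) *ᵥ z) = ((∑ i, p i * ‖z i‖ ^ 2 : ℝ) : ℂ) := by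
    rw [hρ.1.1.star_mul_mul_eigenvectorUnitary, dotProduct, Complex.ofReal_sum]
    refine Finset.sum_congr rfl fun i _ => ?_
    rw [Matrix.mulVec_diagonal, Complex.ofReal_mul, ← Complex.star_mul_self_eq]
    exact mul_left_comm _ _ _
  rw [Matrix.sub_mulVec, dotProduct_sub, hconj, hconj, h1, h2, hUz, Complex.sub_re,
    Complex.ofReal_re, Complex.ofReal_re] at key
  obtain ⟨i₀, -, hi₀⟩ : ∃ i ∈ Finset.univ, ‖v.1 i‖ ^ 2 ≠ 0 :=
    Finset.exists_ne_zero_of_sum_ne_zero (by rw [sum_norm_sq_sphere]; exact one_ne_zero)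
  have hv0 : 0 < ‖v.1 i₀‖ ^ 2 := lt_of_le_of_ne (sq_nonneg _) (Ne.symm hi₀)
  have hq0 : 0 < q := Finset.sum_pos'
    (fun i _ => mul_nonneg (inv_pos.2 (hp i)).le (sq_nonneg _))
    ⟨i₀, Finset.mem_univ _, mul_pos (inv_pos.2 (hp i₀)) hv0⟩
  have hz0 : 0 < ∑ i, ‖z i‖ ^ 2 := Finset.sum_pos' (fun i _ => sq_nonneg _)
    ⟨i₀, Finset.mem_univ _, by rw [hzn]; exact mul_pos (pow_pos (inv_pos.2 (hp i₀)) 2) hv0⟩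
  have hqz : q = ∑ i, p i * ‖z i‖ ^ 2 + ε * ∑ i, ‖z i‖ ^ 2 := by
    rw [Finset.mul_sum, ← Finset.sum_add_distrib]
    refine Finset.sum_congr rfl fun i _ => ?_
    rw [hzn, ← add_mul]
    have := (hp i).ne'
    field_simp
  have : halfTraceNorm (ψ.1 - ρ) * ∑ i, ‖z i‖ ^ 2 < ε * ∑ i, ‖z i‖ ^ 2 :=
    mul_lt_mul_of_pos_right hψ hz0
  have hlt : q ^ 2 < q := by linarith
  nlinarith

/-- Rotating to the eigenbasis of `ρ` preserves the measure and carries the ball into `G`. Only `G`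
needs to be measurable. -/
theorem pureMeasure_real_epsBall_le_of_forall {d : ℕ} (hd : 1 ≤ d)
    {ρ : Matrix (Fin d) (Fin d) ℂ} (hρ : IsDensity ρ) {ε : ℝ} (hε : 0 < ε)
    {G : Set (PureState d)} (hG : MeasurableSet G)
    (h : ∀ v, ∑ i, (hρ.1.1.eigenvalues i + ε)⁻¹ * ‖v.1 i‖ ^ 2 < 1 → ketbra v ∈ G) :
    (pureMeasure d).real (epsBall ε ρ) ≤ (pureMeasure d).real G := by
  have := isProbabilityMeasure_pureMeasure hd
  set T := unitaryConj (hρ.1.1.eigenvectorUnitary)⁻¹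
  calc (pureMeasure d).real (epsBall ε ρ) ≤ (pureMeasure d).real (T ⁻¹' G) := by
        refine measureReal_mono fun ψ hψ => ?_
        obtain ⟨v, hv⟩ := ketbra_surjective (T ψ)
        rw [Set.mem_preimage, ← hv]
        exact h v (sum_inv_mul_norm_sq_lt_one hρ hε hψ hv.symm)
    _ = ((pureMeasure d).map T).real G :=
        (map_measureReal_apply (continuous_unitaryConj _).measurable hG).symm
    _ = (pureMeasure d).real G := by rw [map_unitaryConj_pureMeasure]

theorem pureMeasure_real_epsBall_le {n : ℕ} {ρ : Matrix (Fin (n + 1)) (Fin (n + 1)) ℂ}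
    (hρ : IsDensity ρ) {ε : ℝ} (hε : 0 < ε) (hε2 : ε ≤ 1 / 2) {b : ℝ} (hb : 0 ≤ b)
    (h : ∀ t < ε, ∀ p : Fin n → ℝ, (∀ j, 0 ≤ p j) → ∑ j, p j = t →
      ∏ j, (ε - t) * (p j + ε) / (1 - t - p j) ≤ b) :
    (pureMeasure (n + 1)).real (epsBall ε ρ) ≤ b := by
  set p := hρ.1.1.eigenvalues
  have hp (i : Fin (n + 1)) : 0 ≤ p i := hρ.1.eigenvalues_nonneg i
  have hsum : ∑ i, p i = 1 := by
    have h1 : ((∑ i, p i : ℝ) : ℂ) = 1 :=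
      (Complex.ofReal_sum _ _).trans (hρ.1.1.trace_eq_sum_eigenvalues.symm.trans hρ.2)
    exact Complex.ofReal_eq_one.1 h1
  by_cases hmax : ∃ i, 1 - ε < p i
  · obtain ⟨i₀, hi₀⟩ := hmax
    set t := 1 - p i₀
    have htε : t < ε := by linarith
    have hpt : ∑ j, p (i₀.succAbove j) = t := by
      rw [Fin.sum_univ_succAbove _ i₀] at hsum
      linarith
    have hple (j : Fin n) : p (i₀.succAbove j) ≤ t :=
      hpt ▸ Finset.single_le_sum (fun i _ => hp (i₀.succAbove i)) (Finset.mem_univ j)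
    have ht1 : 0 < 1 - t + ε := by linarith
    have hεt : 0 < ε - t := by linarith
    -- Subtracting `∑ |v i|² = 1` makes the condition homogeneous, with coefficients `(p i + ε)⁻¹ -
    -- 1`. Only the one at `i₀` is negative, equal to `-(ε - t) / (1 - t + ε)`; dividing by its
    -- absolute value gives `k`.
    set k : Fin n → ℝ := fun j =>
      (1 - ε - p (i₀.succAbove j)) * (1 - t + ε) / ((p (i₀.succAbove j) + ε) * (ε - t)) with hkdef
    have hpe (j : Fin n) : 0 < p (i₀.succAbove j) + ε := by linarith [hp (i₀.succAbove j)]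
    have hk (j : Fin n) : 0 ≤ k j :=
      div_nonneg (mul_nonneg (by linarith [hple j]) ht1.le) (mul_nonneg (hpe j).le hεt.le)
    set G : Set (PureState (n + 1)) :=
      {ψ | ∑ j, k j * (ψ.1 (i₀.succAbove j) (i₀.succAbove j)).re ≤ (ψ.1 i₀ i₀).re}
    have hG : MeasurableSet G := by
      have hc (i : Fin (n + 1)) : Continuous fun ψ : PureState (n + 1) => (ψ.1 i i).re :=
        Complex.continuous_re.comp (continuous_subtype_val.matrix_elem i i)
      exact (isClosed_le (continuous_finsetSum _ fun j _ => (hc _).const_mul _)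
        (hc i₀)).measurableSet
    refine (pureMeasure_real_epsBall_le_of_forall (by omega) hρ hε hG fun v hv => ?_).trans ?_
    · have hv1 := sum_norm_sq_sphere v
      rw [Fin.sum_univ_succAbove _ i₀] at hv hv1
      simp only [G, Set.mem_ofPred_eq, ketbra_apply_self, Complex.ofReal_re]
      have hi₀' : hρ.1.1.eigenvalues i₀ = 1 - t := by simp [t, p]
      have hkj (j : Fin n) : k j * ‖v.1 (i₀.succAbove j)‖ ^ 2 = (1 - t + ε) / (ε - t) *
          ((p (i₀.succAbove j) + ε)⁻¹ * ‖v.1 (i₀.succAbove j)‖ ^ 2 -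
            ‖v.1 (i₀.succAbove j)‖ ^ 2) := by
        have := (hpe j).ne'
        simp only [hkdef]
        field_simp
        ring
      rw [Finset.sum_congr rfl fun j _ => hkj j, ← Finset.mul_sum, Finset.sum_sub_distrib,
        div_mul_eq_mul_div, div_le_iff₀ hεt]
      rw [hi₀'] at hv
      have h2 : ∑ j, (p (i₀.succAbove j) + ε)⁻¹ * ‖v.1 (i₀.succAbove j)‖ ^ 2 -
          ∑ j, ‖v.1 (i₀.succAbove j)‖ ^ 2 ≤
          ‖v.1 i₀‖ ^ 2 - (1 - t + ε)⁻¹ * ‖v.1 i₀‖ ^ 2 := by linarith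
      calc _ ≤ (1 - t + ε) * (‖v.1 i₀‖ ^ 2 - (1 - t + ε)⁻¹ * ‖v.1 i₀‖ ^ 2) := by gcongr
        _ = _ := by
          field_simp
          ring
    · rw [pureMeasure, map_measureReal_apply continuous_ketbra.measurable hG]
      have hpre : ketbra ⁻¹' G =
          {v | ∑ j, k j * ‖v.1 (i₀.succAbove j)‖ ^ 2 ≤ ‖v.1 i₀‖ ^ 2} := by
        ext v
        simp only [G, Set.mem_preimage, Set.mem_ofPred_eq, ketbra_apply_self, Complex.ofReal_re]
      rw [hpre, sphereUniform_real_cone i₀ hk]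
      refine (Finset.prod_congr rfl fun j _ => ?_).trans_le
        (h t htε (fun j => p (i₀.succAbove j)) (fun j => hp _) hpt)
      have h3 := (hpe j).ne'
      have h4 : 1 - t - p (i₀.succAbove j) ≠ 0 := by
        have := hple j
        exact ne_of_gt (by linarith)
      have h5 : 1 + k j = (1 - t - p (i₀.succAbove j)) / ((ε - t) * (p (i₀.succAbove j) + ε)) := by
        simp only [hkdef]
        field_simp
        ring
      rw [h5, inv_div]
  -- Every coefficient `(p i + ε)⁻¹` is at least 1, so the ball is empty.
  · push Not at hmax
    refine (pureMeasure_real_epsBall_le_of_forall (by omega) hρ hε MeasurableSet.empty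
      fun v hv => ?_).trans (by simpa using hb)
    refine absurd hv (not_lt.2 ?_)
    refine (sum_norm_sq_sphere v).symm.trans_le ?_
    refine Finset.sum_le_sum fun i _ => le_mul_of_one_le_left (sq_nonneg _) ?_
    exact (one_le_inv₀ (add_pos_of_nonneg_of_pos (hp i) hε)).2 (by linarith [hmax i])

/-! ### From ball measures to covering numbers -/

/-- Pure states form a compact set, the continuous image of the sphere. Existence is essential:
`sInf ∅ = 0` in `ℕ` would break the lower bound. -/
theorem exists_isExternalCovering (d : ℕ) {ε : ℝ} (hε : 0 < ε) :
    ∃ S : Finset (Matrix (Fin d) (Fin d) ℂ), IsExternalCovering d ε S := by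
  classical
  have hcomp : IsCompact (Set.univ : Set (PureState d)) := by
    rw [← ketbra_surjective.range_eq]
    exact isCompact_range continuous_ketbra
  have hopen (φ : PureState d) : IsOpen {ψ : PureState d |
      1 / 2 * √(d * ((ψ.1 - φ.1) * (ψ.1 - φ.1).conjTranspose).trace.re) < ε} := by
    refine isOpen_lt (continuous_const.mul (Real.continuous_sqrt.comp
      (continuous_const.mul (Complex.continuous_re.comp ?_)))) continuous_const
    fun_prop
  obtain ⟨t, ht⟩ := hcomp.elim_finite_subcover _ hopen fun ψ _ =>
    Set.mem_iUnion.2 ⟨ψ, by simpa using hε⟩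
  refine ⟨t.image Subtype.val, fun ρ hρ => ?_, fun φ => ?_⟩
  · obtain ⟨ψ, -, rfl⟩ := Finset.mem_image.1 hρ
    exact ψ.2.1
  · obtain ⟨ψ, hψ, h⟩ := Set.mem_iUnion₂.1 (ht (Set.mem_univ φ))
    exact ⟨ψ.1, Finset.mem_image_of_mem _ hψ, halfTraceNorm_le_sqrt.trans_lt h⟩

theorem inv_le_externalCoveringNumber {d : ℕ} (hd : 1 ≤ d) {ε : ℝ} (hε : 0 < ε) {b : ℝ}
    (hb : 0 < b) (h : ∀ ρ : Matrix (Fin d) (Fin d) ℂ, IsDensity ρ →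
      (pureMeasure d).real (epsBall ε ρ) ≤ b) :
    b⁻¹ ≤ (externalCoveringNumber d ε : ℝ) := by
  have := isProbabilityMeasure_pureMeasure hd
  obtain ⟨S₀, hS₀⟩ := exists_isExternalCovering d hε
  obtain ⟨S, hS, hcard⟩ : ∃ S, IsExternalCovering d ε S ∧ S.card = externalCoveringNumber d ε :=
    Nat.sInf_mem (s := {n : ℕ | ∃ S, IsExternalCovering d ε S ∧ S.card = n})
      ⟨S₀.card, S₀, hS₀, rfl⟩
  rw [← hcard, inv_le_iff_one_le_mul₀ hb]
  have hcov : (Set.univ : Set (PureState d)) ⊆ ⋃ ρ ∈ S, epsBall ε ρ := fun ψ _ => by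
    obtain ⟨ρ, hρ, hlt⟩ := hS.2 ψ
    exact Set.mem_iUnion₂.2 ⟨ρ, hρ, hlt⟩
  calc (1 : ℝ) = (pureMeasure d).real Set.univ := by simp
    _ ≤ (pureMeasure d).real (⋃ ρ ∈ S, epsBall ε ρ) := measureReal_mono hcov (measure_ne_top _ _)
    _ ≤ ∑ ρ ∈ S, (pureMeasure d).real (epsBall ε ρ) := measureReal_biUnion_finset_le _ _
    _ ≤ ∑ _ρ ∈ S, b := Finset.sum_le_sum fun ρ hρ => h ρ (hS.1 ρ hρ)
    _ = S.card * b := by simp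

theorem lemma2 (d : ℕ) (hd : 1 ≤ d) (ε : ℝ) (hε : ε ∈ Set.Ioc (0 : ℝ) (1 / 2)) :
    ((1 / (2 * ε)) ^ (2 * (d - 1)) ≤ (externalCoveringNumber d ε : ℝ) ∧
      (4 ≤ d → (1 / ε) ^ (2 * (d - 1)) ≤ (externalCoveringNumber d ε : ℝ))) ∧
    ∀ ρ : Matrix (Fin d) (Fin d) ℂ, IsDensity ρ →
      (pureMeasure d).real (epsBall ε ρ) ≤ (2 * ε) ^ (2 * (d - 1)) ∧
      (4 ≤ d → (pureMeasure d).real (epsBall ε ρ) ≤ ε ^ (2 * (d - 1))) := by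
  obtain ⟨n, rfl⟩ : ∃ n, d = n + 1 := ⟨d - 1, by omega⟩
  obtain ⟨hε0, hε2⟩ := hε
  simp only [Nat.add_sub_cancel]
  have h1 (ρ : Matrix (Fin (n + 1)) (Fin (n + 1)) ℂ) (hρ : IsDensity ρ) :
      (pureMeasure (n + 1)).real (epsBall ε ρ) ≤ (2 * ε) ^ (2 * n) :=
    pureMeasure_real_epsBall_le hρ hε0 hε2 (by positivity) fun t ht p hp hsum =>
      prod_capFactor_le_two_mul hε2 ht hp hsum
  have h2 (h4 : 4 ≤ n + 1) (ρ : Matrix (Fin (n + 1)) (Fin (n + 1)) ℂ) (hρ : IsDensity ρ) :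
      (pureMeasure (n + 1)).real (epsBall ε ρ) ≤ ε ^ (2 * n) :=
    pureMeasure_real_epsBall_le hρ hε0 hε2 (by positivity) fun t ht p hp hsum =>
      prod_capFactor_le (by omega) hε2 ht hp hsum
  refine ⟨⟨?_, fun h4 => ?_⟩, fun ρ hρ => ⟨h1 ρ hρ, fun h4 => h2 h4 ρ hρ⟩⟩
  · rw [one_div, inv_pow]
    exact inv_le_externalCoveringNumber hd hε0 (by positivity) h1
  · rw [one_div, inv_pow]
    exact inv_le_externalCoveringNumber hd hε0 (by positivity) (h2 h4)
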